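/- Let $0<v_{min}<v_{max}$, $\kappa\ge 0$, $\theta,v_0\in[v_{min},v_{max}]$, $\sigma,\delta,x_0\in\mathbb R$, $r>0$, $\rho^2<1$, $T>0$, and let $(V,X)$ be a solution on $[0,T]$, with values in $[v_{min},v_{max}]\times\mathbb R$ and $(V_0,X_0)=(v_0,x_0)$, of the stochastic volatility Jacobi model $$dV_t=\kappa(\theta-V_t)\,dt+\sigma\sqrt{Q(V_t)}\,dW_t,\qquad dX_t=(r-\delta-V_t/2)\,dt+\rho\sqrt{Q(V_t)}\,dW_t+\sqrt{V_t-\rho^2Q(V_t)}\,dW_t^{\perp},$$ where $Q(v)=\frac{(v-v_{min})(v_{max}-v)}{(\sqrt{v_{max}}-\sqrt{v_{min}})^2}$ and $W,W^\perp$ are independent standard Brownian motions (solutions are understood in the weak sense, i.e. through the associated martingale problem). Let $w$ be the Gaussian density with mean $\mu_w\in\mathbb R$ and variance $\sigma_w^2>v_{max}T/2$, let $H_n(x)=\frac1{\sqrt{n!}}\mathcal H_n\!\left(\frac{x-\mu_w}{\sigma_w}\right)$ with $\mathcal H_n$ the probabilists' Hermite polynomials, and let $\ell_n=\mathbb E[H_n(X_T)]$.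 Fix an integer $M>0$ and put $$g_T^{(M)}(x)=\sum_{n=0}^M \ell_n H_n(x)w(x),\qquad x\in\mathbb R.$$ Assume that $g_T^{(M)}\ge 0$, so that it is a probability density, and let $X_T^{(M)}$ be a random variable with this density. For each $N\ge1$ let $\Gamma_N=\{x_1,\dots,x_N\}$ be an optimal quadratic quantizer of $X_T^{(M)}$, i.e. $N$ distinct points minimizing $(y_1,\dots,y_N)\mapsto \mathbb E\big[\min_{1\le i\le N}|X_T^{(M)}-y_i|^2\big]$ over $\mathbb R^N$, and let $(C_i(\Gamma_N))_{1\le i\le N}$ be an associated Voronoi partition, i.e. a Borel partition of $\mathbb R$ with $C_i(\Gamma_N)\subset\{\xi:|\xi-x_i|=\min_j|\xi-x_j|\}$. For a strike $K\in\mathbb R$ let $$\mathrm{err}^2_{M,N}=\left|e^{-rT}\int_{\mathbb R}(e^x-K)^+g_T^{(M)}(x)\,dx-e^{-rT}\sum_{i=1}^N\int_{C_i(\Gamma_N)}(e^{x_i}-K)^+g_T^{(M)}(x)\,dx\right|$$ (the superscript $2$ is an index, not a square). Then $S_T^{(M)}=e^{X_T^{(M)}}$ has density $h_T^{(M)}(s)=g_T^{(M)}(\ln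 s)/s$ on $(0,\infty)$, the quantity $\|h_T^{(M)}\|_{1/3}=\left(\int_0^\infty h_T^{(M)}(s)^{1/3}\,ds\right)^{3}$ is finite, and $\lim_{N\to\infty}N\,\mathrm{err}^2_{M,N}$ exists and satisfies $$\lim_{N\to\infty}N\,\mathrm{err}^2_{M,N}\le\frac{\|h_T^{(M)}\|_{1/3}^{1/2}}{2\sqrt3}.$$ -/

import Mathlib

open MeasureTheory ProbabilityTheory Filter Topology
open scoped NNReal ENNReal

noncomputable section

namespace SVJ

/-! ### The stochastic volatility Jacobi model -/

/-- The parameters of the stochastic volatility Jacobi model. -/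
structure Params where
  vmin : ℝ
  vmax : ℝ
  κ : ℝ
  θ : ℝ
  σ : ℝ
  ρ : ℝ
  r : ℝ
  δ : ℝ
  v₀ : ℝ
  x₀ : ℝ

/-- The standing restrictions on the parameters. -/
structure Params.Admissible (p : Params) : Prop where
  vmin_pos : 0 < p.vmin
  vmin_lt_vmax : p.vmin < p.vmax
  κ_nonneg : 0 ≤ p.κ
  θ_mem : p.θ ∈ Set.Icc p.vmin p.vmax
  ρ_sq_lt_one : p.ρ ^ 2 < 1
  r_pos : 0 < p.r
  v₀_mem : p.v₀ ∈ Set.Icc p.vmin p.vmax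

/-- `Q(v) = (v - vmin) (vmax - v) / (√vmax - √vmin)²`. -/
def Params.Q (p : Params) (v : ℝ) : ℝ :=
  (v - p.vmin) * (p.vmax - v) / (√p.vmax - √p.vmin) ^ 2

/-- Partial derivative in the first variable. -/
def dv (f : ℝ × ℝ → ℝ) (y : ℝ × ℝ) : ℝ := fderiv ℝ f y (1, 0)

/-- Partial derivative in the second variable. -/
def dx (f : ℝ × ℝ → ℝ) (y : ℝ × ℝ) : ℝ := fderiv ℝ f y (0, 1)

/-- The generator `b(v)ᵀ ∇f + ½ Tr (a(v) ∇²f)` of the model, evaluated at `y = (v, x)`, where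
`b(v) = (κ(θ - v), r - δ - v/2)` and `a(v) = [[σ² Q(v), ρσ Q(v)], [ρσ Q(v), v]]`. -/
def Params.generator (p : Params) (f : ℝ × ℝ → ℝ) (y : ℝ × ℝ) : ℝ :=
  p.κ * (p.θ - y.1) * dv f y + (p.r - p.δ - y.1 / 2) * dx f y
    + 1 / 2 * (p.σ ^ 2 * p.Q y.1 * dv (dv f) y + 2 * (p.ρ * p.σ * p.Q y.1 * dv (dx f) y)
        + y.1 * dx (dx f) y)

/-- `(V, X)` is a (weak) solution on `[0, T]`, with values in `[vmin, vmax] × ℝ`, of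
`dV = κ(θ - V) dt + σ √Q(V) dW`,
`dX = (r - δ - V/2) dt + ρ √Q(V) dW + √(V - ρ² Q(V)) dW^⊥`, `(V₀, X₀) = (v₀, x₀)`,
in the sense of the martingale problem for the generator.
Only the values of `V` and `X` at times in `[0, T]` matter. -/
structure IsSolution (p : Params) (T : ℝ) {Ω : Type*} {mΩ : MeasurableSpace Ω}
    (ℱ : Filtration (Set.Icc (0 : ℝ) T) mΩ) (P : Measure Ω) (V X : ℝ → Ω → ℝ) : Prop where
  adapted_V : ∀ t : Set.Icc (0 : ℝ) T, Measurable[ℱ t] (V t)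
  adapted_X : ∀ t : Set.Icc (0 : ℝ) T, Measurable[ℱ t] (X t)
  continuous_V : ∀ᵐ ω ∂P, ContinuousOn (fun t => V t ω) (Set.Icc 0 T)
  continuous_X : ∀ᵐ ω ∂P, ContinuousOn (fun t => X t ω) (Set.Icc 0 T)
  init_V : ∀ᵐ ω ∂P, V 0 ω = p.v₀
  init_X : ∀ᵐ ω ∂P, X 0 ω = p.x₀
  range_V : ∀ᵐ ω ∂P, ∀ t ∈ Set.Icc (0 : ℝ) T, V t ω ∈ Set.Icc p.vmin p.vmax
  martingale : ∀ f : ℝ × ℝ → ℝ, ContDiff ℝ ((⊤ : ℕ∞) : WithTop ℕ∞) f → HasCompactSupport f →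
    Martingale (fun (t : Set.Icc (0 : ℝ) T) ω =>
      f (V t ω, X t ω) - ∫ s in (0 : ℝ)..t, p.generator f (V s ω, X s ω)) ℱ P

/-! ### The truncated Hermite expansion of the density -/

/-- The Gaussian weight: the density of the normal law with mean `μw` and variance `σw²`. -/
def weight (μw : ℝ) (σw : ℝ≥0) (x : ℝ) : ℝ := gaussianPDFReal μw (σw ^ 2) x

/-- The generalized Hermite polynomials, an orthonormal basis of `L²(w dx)`. -/
def genHermite (μw : ℝ) (σw : ℝ≥0) (n : ℕ) (x : ℝ) : ℝ :=
  1 / √(n.factorial : ℝ) * Polynomial.aeval ((x - μw) / σw) (Polynomial.hermite n)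

/-- The Hermite moment `ℓₙ = E[Hₙ(Y)]` of a random variable `Y`; it is `∫ Hₙ(x) g(x) dx` when `Y`
has density `g`. -/
def hermiteMoment {Ω : Type*} [MeasurableSpace Ω] (P : Measure Ω) (Y : Ω → ℝ)
    (μw : ℝ) (σw : ℝ≥0) (n : ℕ) : ℝ :=
  ∫ ω, genHermite μw σw n (Y ω) ∂P

/-- The truncated density `g^{(M)}(x) = ∑_{n ≤ M} ℓₙ Hₙ(x) w(x)`. -/
def truncDensity {Ω : Type*} [MeasurableSpace Ω] (P : Measure Ω) (Y : Ω → ℝ)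
    (μw : ℝ) (σw : ℝ≥0) (M : ℕ) (x : ℝ) : ℝ :=
  ∑ n ∈ Finset.range (M + 1),
    hermiteMoment P Y μw σw n * genHermite μw σw n x * weight μw σw x

/-- The law on `ℝ` with density `g`. -/
def densityLaw (g : ℝ → ℝ) : Measure ℝ := volume.withDensity fun x => ENNReal.ofReal (g x)

/-- `h(s) = g(ln s) / s`. -/
def expDensity (g : ℝ → ℝ) (s : ℝ) : ℝ := g (Real.log s) / s

/-! ### Optimal quadratic quantization -/

/-- The quadratic distortion `E[min_i |Y - x_i|²]` of the grid `x`, where `Y` has law `P`. -/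
def distortion (P : Measure ℝ) {N : ℕ} (x : Fin N → ℝ) : ℝ :=
  ∫ ξ, ⨅ i, |ξ - x i| ^ 2 ∂P

/-- `x` is an optimal quadratic quantizer (with pairwise distinct points) of the law `P`. -/
structure IsOptimalQuantizer (P : Measure ℝ) {N : ℕ} (x : Fin N → ℝ) : Prop where
  injective : Function.Injective x
  minimal : ∀ y : Fin N → ℝ, distortion P x ≤ distortion P y

/-- `C` is a Voronoi partition of `ℝ` associated with the grid `x`. -/
structure IsVoronoiPartition {N : ℕ} (x : Fin N → ℝ) (C : Fin N → Set ℝ) : Prop where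
  measurable : ∀ i, MeasurableSet (C i)
  disjoint : Pairwise fun i j => Disjoint (C i) (C j)
  cover : ⋃ i, C i = Set.univ
  nearest : ∀ i, ∀ ξ ∈ C i, ∀ j, |ξ - x i| ≤ |ξ - x j|

/-! ### Call prices -/

/-- Price of the call with strike `K` and maturity `T` when the log price has density `g`. -/
def callPrice (r T K : ℝ) (g : ℝ → ℝ) : ℝ :=
  Real.exp (-r * T) * ∫ x, max (Real.exp x - K) 0 * g x

/-- Call price when the log price with density `g` is quantized on the grid `x` with cells `C`. -/
def quantizedCallPrice (r T K : ℝ) (g : ℝ → ℝ) {N : ℕ} (x : Fin N → ℝ) (C : Fin N → Set ℝ) : ℝ :=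
  Real.exp (-r * T) * ∑ i, ∫ ξ in C i, max (Real.exp (x i) - K) 0 * g ξ

/-- The quantization error. -/
def quantError (r T K : ℝ) (g : ℝ → ℝ) {N : ℕ} (x : Fin N → ℝ) (C : Fin N → Set ℝ) : ℝ :=
  |callPrice r T K g - quantizedCallPrice r T K g x C|

end SVJ

end

/-! The limit is `0`, so the bound reduces to nonnegativity of its right-hand side. Let `Y` have
density `g`, let `Ŷ` be its projection on the optimal grid, and let `f` be the payoff in the log
price, with slope `f'`. Optimality makes the grid stationary, `E[f'(Ŷ)(Y - Ŷ)] = 0`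
(`integral_comp_mul_sub_eq_zero`), so the weak error is `E[f(Y) - f(Ŷ) - f'(Ŷ)(Y - Ŷ)]`. The
subgradient inequality at both ends bounds this remainder by `|f'(Y) - f'(Ŷ)| |Y - Ŷ|`
(`abs_callPayoff_sub_sub_le`). By Cauchy-Schwarz, `N` times the error is at most `N ‖Y - Ŷ‖₂ ‖f'(Y)
- f'(Ŷ)‖₂`. The factor `N ‖Y - Ŷ‖₂` is bounded, by comparison with an explicit grid
(`sq_mul_distortion_le`). The slope factor tends to `0`, because `Ŷ → Y` on the support and `f'`
jumps at one point at most, which is null (`tendsto_integral_callSlope_sub_sq`). All integrability,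
including that of `h ^ (1/3)`, comes from the decay of a polynomial times a Gaussian. -/

namespace SVJ

/-! ### Voronoi projections -/

/-- The nearest-point projection onto the grid `x` determined by the partition `C`. -/
noncomputable def voronoiProj {N : ℕ} (x : Fin N → ℝ) (C : Fin N → Set ℝ) (ξ : ℝ) : ℝ :=
  ∑ i, (C i).indicator (fun _ => x i) ξ

section Voronoi

variable {N : ℕ} {x : Fin N → ℝ} {C : Fin N → Set ℝ}

theorem IsVoronoiPartition.exists_mem (hC : IsVoronoiPartition x C) (ξ : ℝ) : ∃ i, ξ ∈ C i := by
  have h : ξ ∈ ⋃ i, C i := hC.cover ▸ Set.mem_univ ξ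
  simpa using h

theorem IsVoronoiPartition.voronoiProj_eq (hC : IsVoronoiPartition x C) {i : Fin N} {ξ : ℝ}
    (hξ : ξ ∈ C i) : voronoiProj x C ξ = x i := by
  unfold voronoiProj
  rw [Finset.sum_eq_single i]
  · simp [hξ]
  · intro j _ hj
    exact Set.indicator_of_notMem (fun h => Set.disjoint_left.1 (hC.disjoint hj) h hξ) _
  · simp

theorem IsVoronoiPartition.measurable_voronoiProj (hC : IsVoronoiPartition x C) :
    Measurable (voronoiProj x C) :=
  Finset.measurable_fun_sum _ fun i _ => measurable_const.indicator (hC.measurable i)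

/-- The projection takes finitely many values, so no growth condition on `c` is needed. -/
theorem IsVoronoiPartition.exists_abs_comp_le (hC : IsVoronoiPartition x C) (c : ℝ → ℝ) :
    ∃ B, ∀ ξ, |c (voronoiProj x C ξ)| ≤ B := by
  refine ⟨∑ i, |c (x i)|, fun ξ => ?_⟩
  obtain ⟨i, hi⟩ := hC.exists_mem ξ
  rw [hC.voronoiProj_eq hi]
  exact Finset.single_le_sum (f := fun i => |c (x i)|) (fun _ _ => abs_nonneg _)
    (Finset.mem_univ i)

theorem IsVoronoiPartition.abs_sub_voronoiProj_le (hC : IsVoronoiPartition x C) (ξ : ℝ)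
    (j : Fin N) : |ξ - voronoiProj x C ξ| ≤ |ξ - x j| := by
  obtain ⟨i, hi⟩ := hC.exists_mem ξ
  rw [hC.voronoiProj_eq hi]
  exact hC.nearest i ξ hi j

theorem iInf_abs_sub_sq_le (y : Fin N → ℝ) (ξ : ℝ) (i : Fin N) :
    ⨅ i, |ξ - y i| ^ 2 ≤ |ξ - y i| ^ 2 :=
  ciInf_le (Set.finite_range _).bddBelow i

theorem iInf_abs_sub_sq_nonneg (y : Fin N → ℝ) (ξ : ℝ) : 0 ≤ ⨅ i, |ξ - y i| ^ 2 :=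
  Real.iInf_nonneg fun _ => by positivity

theorem IsVoronoiPartition.iInf_eq (hC : IsVoronoiPartition x C) (ξ : ℝ) :
    ⨅ i, |ξ - x i| ^ 2 = (ξ - voronoiProj x C ξ) ^ 2 := by
  obtain ⟨i, hi⟩ := hC.exists_mem ξ
  have : Nonempty (Fin N) := ⟨i⟩
  rw [hC.voronoiProj_eq hi, ← sq_abs]
  refine le_antisymm (iInf_abs_sub_sq_le x ξ i) (le_ciInf fun j => ?_)
  exact pow_le_pow_left₀ (abs_nonneg _) (hC.nearest i ξ hi j) 2

theorem IsVoronoiPartition.distortion_eq (hC : IsVoronoiPartition x C) (μ : Measure ℝ) :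
    distortion μ x = ∫ ξ, (ξ - voronoiProj x C ξ) ^ 2 ∂μ :=
  integral_congr_ae (.of_forall hC.iInf_eq)

variable {μ : Measure ℝ} [IsFiniteMeasure μ]

theorem IsVoronoiPartition.integrable_comp (hC : IsVoronoiPartition x C) {c : ℝ → ℝ}
    (hc : Measurable c) : Integrable (fun ξ => c (voronoiProj x C ξ)) μ := by
  obtain ⟨B, hB⟩ := hC.exists_abs_comp_le c
  exact Integrable.of_bound (hc.comp hC.measurable_voronoiProj).aestronglyMeasurable B
    (.of_forall hB)

theorem IsVoronoiPartition.memLp_comp (hC : IsVoronoiPartition x C) {c : ℝ → ℝ}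
    (hc : Measurable c) : MemLp (fun ξ => c (voronoiProj x C ξ)) 2 μ := by
  obtain ⟨B, hB⟩ := hC.exists_abs_comp_le c
  exact MemLp.of_bound (hc.comp hC.measurable_voronoiProj).aestronglyMeasurable B
    (.of_forall hB)

theorem IsVoronoiPartition.memLp_sub (hC : IsVoronoiPartition x C)
    (hμ : MemLp (fun ξ : ℝ => ξ) 2 μ) : MemLp (fun ξ => ξ - voronoiProj x C ξ) 2 μ :=
  hμ.sub (hC.memLp_comp measurable_id)

/-- An optimal quantizer is stationary: `E[c(Ŷ) (Y - Ŷ)] = 0`. -/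
theorem IsOptimalQuantizer.integral_comp_mul_sub_eq_zero (hx : IsOptimalQuantizer μ x)
    (hC : IsVoronoiPartition x C) (hμ : MemLp (fun ξ : ℝ => ξ) 2 μ) {c : ℝ → ℝ}
    (hc : Measurable c) :
    ∫ ξ, c (voronoiProj x C ξ) * (ξ - voronoiProj x C ξ) ∂μ = 0 := by
  set π := voronoiProj x C with hπ
  have hs := hC.memLp_sub hμ
  have hcm := hC.memLp_comp (μ := μ) hc
  have i1 : Integrable (fun ξ => c (π ξ) * (ξ - π ξ)) μ := hcm.integrable_mul hs
  have i2 : Integrable (fun ξ => (ξ - π ξ) ^ 2) μ := hs.integrable_sq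
  have i3 : Integrable (fun ξ => c (π ξ) ^ 2) μ := hcm.integrable_sq
  set A := ∫ ξ, c (π ξ) * (ξ - π ξ) ∂μ
  set B := ∫ ξ, c (π ξ) ^ 2 ∂μ
  have hB : 0 ≤ B := integral_nonneg fun _ => sq_nonneg _
  have key : ∀ t : ℝ, 0 ≤ -(2 * t) * A + t ^ 2 * B := by
    intro t
    have i5 : Integrable (fun ξ => -(2 * t) * (c (π ξ) * (ξ - π ξ)) + t ^ 2 * c (π ξ) ^ 2) μ :=
      (i1.const_mul _).add (i3.const_mul _)
    have i4 : Integrable (fun ξ => (ξ - π ξ) ^ 2 + (-(2 * t) * (c (π ξ) * (ξ - π ξ)) +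
        t ^ 2 * c (π ξ) ^ 2)) μ := i2.add i5
    -- Move each point `x i` to `x i + t * c (x i)` while keeping the old cells: this can only
    -- overestimate the distortion of the moved grid.
    have hle : ∀ ξ, ⨅ i, |ξ - (x i + t * c (x i))| ^ 2 ≤ (ξ - π ξ) ^ 2 +
        (-(2 * t) * (c (π ξ) * (ξ - π ξ)) + t ^ 2 * c (π ξ) ^ 2) := by
      intro ξ
      obtain ⟨i, hi⟩ := hC.exists_mem ξ
      refine (iInf_abs_sub_sq_le (fun i => x i + t * c (x i)) ξ i).trans (le_of_eq ?_)
      rw [hπ, hC.voronoiProj_eq hi, sq_abs]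
      ring
    have h := hx.minimal fun i => x i + t * c (x i)
    rw [hC.distortion_eq μ] at h
    have h2 := h.trans (integral_mono_of_nonneg
      (.of_forall fun ξ => iInf_abs_sub_sq_nonneg _ ξ) i4 (.of_forall hle))
    rw [integral_add i2 i5,
      integral_add (i1.const_mul _) (i3.const_mul _), integral_const_mul, integral_const_mul] at h2
    linarith
  -- A quadratic in `t` without constant term is nonnegative only if its linear part vanishes. The
  -- minimizer would be `A / B`; the `+ 1` covers `B = 0`.
  have h := key (A / (B + 1))
  have h2 : -(2 * (A / (B + 1))) * A + (A / (B + 1)) ^ 2 * B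
      = -(A ^ 2 * (B + 2) / (B + 1) ^ 2) := by
    field_simp
    ring
  rw [h2] at h
  have h3 : A ^ 2 * (B + 2) / (B + 1) ^ 2 ≤ 0 := by linarith
  by_contra hA
  have : 0 < A ^ 2 * (B + 2) / (B + 1) ^ 2 := by positivity
  linarith

end Voronoi

/-! ### Rate of the optimal distortion -/

/-- The points `j / (m - j)`, `j < m`, approximate `ξ ≥ 0` up to `(1 + ξ)² / m`. -/
theorem exists_abs_sub_div_le {m : ℕ} (hm : 0 < m) {ξ : ℝ} (hξ : 0 ≤ ξ) :
    ∃ j < m, |ξ - (j : ℝ) / (m - j)| ≤ (1 + ξ) ^ 2 / m := by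
  have hm' : (0 : ℝ) < m := by exact_mod_cast hm
  have h1 : 0 < 1 + ξ := by linarith
  -- `a` solves `a / (m - a) = ξ`; the index sought is its integer part.
  set a : ℝ := m * ξ / (1 + ξ) with ha
  have ha0 : 0 ≤ a := by positivity
  have ham : a < m := by rw [ha, div_lt_iff₀ h1]; nlinarith
  have hj1 := Nat.floor_le ha0
  have hj2 := (Nat.lt_floor_add_one a).le
  have hjm : ⌊a⌋₊ < m := (Nat.floor_lt ha0).2 ham
  refine ⟨⌊a⌋₊, hjm, ?_⟩
  set j : ℝ := (⌊a⌋₊ : ℝ)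
  have hmj : 0 < m - j := by linarith
  have haξ : a * (1 + ξ) = m * ξ := by rw [ha]; field_simp
  have e : ξ - j / (m - j) = (a - j) * (1 + ξ) / (m - j) := by
    field_simp
    linarith
  have hma : m = (m - a) * (1 + ξ) := by linarith
  rw [e, abs_of_nonneg (by have : 0 ≤ a - j := by linarith
                           positivity), div_le_div_iff₀ hmj hm']
  have : (m : ℝ) ≤ (m - j) * (1 + ξ) := by nlinarith
  have h0 : (a - j) * (1 + ξ) ≤ 1 + ξ := by nlinarith
  calc (a - j) * (1 + ξ) * m ≤ (1 + ξ) * m := by gcongr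
    _ ≤ (1 + ξ) * ((m - j) * (1 + ξ)) := by gcongr
    _ = _ := by ring

/-- A grid of `2 * m ≤ N` points, symmetric about `0`, with spacing of order `(1 + ξ²) / m`. -/
theorem exists_grid {m N : ℕ} (hm : 0 < m) (hN : 2 * m ≤ N) :
    ∃ y : Fin N → ℝ, ∀ ξ, ∃ i, |ξ - y i| ≤ (1 + |ξ|) ^ 2 / m := by
  -- Indices below `m` give the points `≥ 0`, the next `m` their negatives. Any further index gives
  -- an irrelevant value, and the repeated `0` is harmless, since competing grids need not be
  -- injective.
  refine ⟨fun i => if (i : ℕ) < m then (i : ℕ) / ((m : ℝ) - (i : ℕ))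
    else -(((i - m : ℕ) : ℝ) / ((m : ℝ) - ((i - m : ℕ) : ℝ))), fun ξ => ?_⟩
  obtain ⟨j, hj, h⟩ := exists_abs_sub_div_le hm (abs_nonneg ξ)
  rcases le_total 0 ξ with h0 | h0
  · refine ⟨⟨j, by omega⟩, ?_⟩
    rw [abs_of_nonneg h0] at h ⊢
    simpa [hj] using h
  · refine ⟨⟨m + j, by omega⟩, ?_⟩
    rw [abs_of_nonpos h0] at h ⊢
    simp only [add_lt_iff_neg_left, not_lt_zero, if_false, add_tsub_cancel_left]
    rw [← abs_neg]
    refine le_trans (le_of_eq ?_) h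
    congr 1
    ring

/-- Only the order `N⁻²` matters, not the sharp constant, so comparison with the grid of
`exists_grid` suffices. The constant `9` is the square of the ratio bound `N ≤ 3 * m` for `m = N /
2`. -/
theorem IsOptimalQuantizer.sq_mul_distortion_le {μ : Measure ℝ}
    (hμ : Integrable (fun ξ : ℝ => (1 + |ξ|) ^ 4) μ) {N : ℕ} (hN : 2 ≤ N) {x : Fin N → ℝ}
    (hx : IsOptimalQuantizer μ x) :
    (N : ℝ) ^ 2 * distortion μ x ≤ 9 * ∫ ξ, (1 + |ξ|) ^ 4 ∂μ := by
  obtain ⟨m, hm, h2, h3⟩ : ∃ m, 0 < m ∧ 2 * m ≤ N ∧ N ≤ 3 * m :=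
    ⟨N / 2, by omega, by omega, by omega⟩
  obtain ⟨y, hy⟩ := exists_grid hm h2
  have hm' : (0 : ℝ) < m := by exact_mod_cast hm
  have h3' : (N : ℝ) ≤ 3 * m := by exact_mod_cast h3
  set I := ∫ ξ, (1 + |ξ|) ^ 4 ∂μ
  have hI : 0 ≤ I := integral_nonneg fun _ => by positivity
  have hD : distortion μ x ≤ 1 / (m : ℝ) ^ 2 * I := by
    refine (hx.minimal y).trans ?_
    rw [← integral_const_mul]
    refine integral_mono_of_nonneg (.of_forall fun ξ => iInf_abs_sub_sq_nonneg _ ξ)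
      (hμ.const_mul _) (.of_forall fun ξ => ?_)
    obtain ⟨i, hi⟩ := hy ξ
    refine (iInf_abs_sub_sq_le y ξ i).trans ((pow_le_pow_left₀ (abs_nonneg _) hi 2).trans
      (le_of_eq ?_))
    beta_reduce
    field_simp
  calc (N : ℝ) ^ 2 * distortion μ x ≤ (3 * m) ^ 2 * (1 / (m : ℝ) ^ 2 * I) := by
        gcongr
        exact integral_nonneg fun ξ => iInf_abs_sub_sq_nonneg _ ξ
    _ = 9 * I := by field_simp; ring

end SVJ

namespace SVJ

/-! ### The call payoff as a convex function of the log price -/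

/-- The call payoff as a function of the log price. -/
noncomputable def callPayoff (K x : ℝ) : ℝ := max (Real.exp x - K) 0

/-- A subgradient of `callPayoff K`. -/
noncomputable def callSlope (K x : ℝ) : ℝ := if K < Real.exp x then Real.exp x else 0

theorem callSlope_nonneg (K x : ℝ) : 0 ≤ callSlope K x := by
  unfold callSlope
  split_ifs <;> positivity

theorem callSlope_le (K x : ℝ) : callSlope K x ≤ Real.exp x := by
  unfold callSlope
  split_ifs
  · exact le_rfl
  · positivity

theorem measurable_callSlope (K : ℝ) : Measurable (callSlope K) :=
  Measurable.ite (measurableSet_lt measurable_const Real.measurable_exp) Real.measurable_exp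
    measurable_const

theorem continuous_callPayoff (K : ℝ) : Continuous (callPayoff K) := by
  unfold callPayoff
  fun_prop

theorem continuousAt_callSlope {K x : ℝ} (hx : Real.exp x ≠ K) :
    ContinuousAt (callSlope K) x := by
  rcases lt_or_gt_of_ne hx with h | h
  · refine (continuousAt_const (y := (0 : ℝ))).congr ?_
    filter_upwards [Real.continuous_exp.continuousAt.eventually_lt continuousAt_const h] with y hy
    simp [callSlope, hy.le]
  · refine Real.continuous_exp.continuousAt.congr ?_
    filter_upwards [continuousAt_const.eventually_lt Real.continuous_exp.continuousAt h] with y hy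
    simp [callSlope, hy]

theorem callSlope_mul_sub_le (K a b : ℝ) :
    callSlope K a * (b - a) ≤ callPayoff K b - callPayoff K a := by
  unfold callSlope callPayoff
  split_ifs with h
  · rw [max_eq_left (by linarith : 0 ≤ Real.exp a - K)]
    have h1 : Real.exp a * (b - a) ≤ Real.exp b - Real.exp a := by
      have e : Real.exp b = Real.exp a * Real.exp (b - a) := by rw [← Real.exp_add]; congr 1; ring
      have := Real.add_one_le_exp (b - a)
      have := Real.exp_pos a
      rw [e]
      nlinarith
    linarith [le_max_left (Real.exp b - K) 0]
  · rw [max_eq_right (by linarith : Real.exp a - K ≤ 0)]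
    simp

/-- Subgradient inequalities at `a` and at `b` place the remainder between `0` and the product of
the two increments. No second derivative is needed, so the kink at the strike is allowed. -/
theorem abs_callPayoff_sub_sub_le (K a b : ℝ) :
    |callPayoff K b - callPayoff K a - callSlope K a * (b - a)|
      ≤ |callSlope K b - callSlope K a| * |b - a| := by
  have h1 := callSlope_mul_sub_le K a b
  have h2 := callSlope_mul_sub_le K b a
  rw [abs_of_nonneg (by linarith), ← abs_mul]
  refine le_trans ?_ (le_abs_self _)
  linarith

/-! ### Integrability -/

section Integrability

variable {μ : Measure ℝ}

theorem integrable_one_add_abs_pow_four (hμ : Integrable (fun ξ : ℝ => Real.exp (4 * |ξ|)) μ) :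
    Integrable (fun ξ : ℝ => (1 + |ξ|) ^ 4) μ := by
  refine hμ.mono' (by fun_prop) (.of_forall fun ξ => ?_)
  have h : Real.exp (4 * |ξ|) = Real.exp |ξ| ^ 4 := by
    rw [← Real.exp_nat_mul]
    norm_num
  rw [Real.norm_of_nonneg (by positivity), h, add_comm]
  gcongr
  exact Real.add_one_le_exp _

theorem memLp_id_two (hμ : Integrable (fun ξ : ℝ => Real.exp (4 * |ξ|)) μ) :
    MemLp (fun ξ : ℝ => ξ) 2 μ := by
  rw [memLp_two_iff_integrable_sq (by fun_prop)]
  refine (integrable_one_add_abs_pow_four hμ).mono' (by fun_prop) (.of_forall fun ξ => ?_)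
  rw [Real.norm_of_nonneg (by positivity), ← sq_abs]
  have h0 := abs_nonneg ξ
  calc |ξ| ^ 2 ≤ (1 + |ξ|) ^ 2 := by gcongr; linarith
    _ ≤ (1 + |ξ|) ^ 4 := pow_le_pow_right₀ (by linarith) (by norm_num)

theorem memLp_callSlope (hμ : Integrable (fun ξ : ℝ => Real.exp (4 * |ξ|)) μ) (K : ℝ) :
    MemLp (callSlope K) 2 μ := by
  have hm := measurable_callSlope K
  rw [memLp_two_iff_integrable_sq hm.aestronglyMeasurable]
  refine hμ.mono' (hm.pow_const 2).aestronglyMeasurable (.of_forall fun ξ => ?_)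
  rw [Real.norm_of_nonneg (by positivity)]
  refine (pow_le_pow_left₀ (callSlope_nonneg K ξ) (callSlope_le K ξ) 2).trans ?_
  rw [← Real.exp_nat_mul, Real.exp_le_exp]
  push_cast
  linarith [le_abs_self ξ, abs_nonneg ξ]

theorem integrable_callPayoff [IsFiniteMeasure μ]
    (hμ : Integrable (fun ξ : ℝ => Real.exp (4 * |ξ|)) μ) (K : ℝ) :
    Integrable (callPayoff K) μ := by
  refine (hμ.add (integrable_const |K|)).mono' (continuous_callPayoff K).aestronglyMeasurable
    (.of_forall fun ξ => ?_)
  have h0 : Real.exp ξ ≤ Real.exp (4 * |ξ|) :=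
    Real.exp_le_exp.2 (by linarith [le_abs_self ξ, abs_nonneg ξ])
  rw [callPayoff, Real.norm_of_nonneg (le_max_right _ _), Pi.add_apply]
  exact max_le (by linarith [neg_abs_le K]) (by positivity)

end Integrability

/-! ### Convergence of the projections on the support -/

section Convergence

variable {μ : Measure ℝ} {Γ : (N : ℕ) → Fin N → ℝ}
  {C : (N : ℕ) → Fin N → Set ℝ}

theorem tendsto_distortion (hμ : Integrable (fun ξ : ℝ => (1 + |ξ|) ^ 4) μ)
    (hΓ : ∀ N, 1 ≤ N → IsOptimalQuantizer μ (Γ N)) :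
    Tendsto (fun N => distortion μ (Γ N)) atTop (𝓝 0) := by
  have h : Tendsto (fun N : ℕ => (9 * ∫ ξ, (1 + |ξ|) ^ 4 ∂μ) * (1 / (N : ℝ)) ^ 2) atTop (𝓝 0) := by
    simpa using ((tendsto_one_div_atTop_nhds_zero_nat (𝕜 := ℝ)).pow 2).const_mul
      (9 * ∫ ξ, (1 + |ξ|) ^ 4 ∂μ)
  refine squeeze_zero' (.of_forall fun N => integral_nonneg fun ξ => iInf_abs_sub_sq_nonneg _ ξ)
    ?_ h
  filter_upwards [eventually_ge_atTop 2] with N hN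
  have hN' : (0 : ℝ) < N := by exact_mod_cast (by omega : 0 < N)
  have := (hΓ N (by omega)).sq_mul_distortion_le hμ hN
  rw [one_div, inv_pow, ← div_eq_mul_inv, le_div_iff₀ (by positivity)]
  linarith

/-- If the grid stays `ε` away from `ξ`, it stays `ε / 2` away from the ball of radius `ε / 2`. That
ball has positive mass, so the distortion could not tend to `0`. -/
theorem tendsto_voronoiProj [IsFiniteMeasure μ] (hμ : Integrable (fun ξ : ℝ => (1 + |ξ|) ^ 4) μ)
    (hμ2 : MemLp (fun ξ : ℝ => ξ) 2 μ)
    (hΓ : ∀ N, 1 ≤ N → IsOptimalQuantizer μ (Γ N))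
    (hC : ∀ N, 1 ≤ N → IsVoronoiPartition (Γ N) (C N)) {ξ : ℝ} (hξ : ξ ∈ μ.support) :
    Tendsto (fun N => voronoiProj (Γ N) (C N) ξ) atTop (𝓝 ξ) := by
  rw [Metric.tendsto_nhds]
  intro ε hε
  have hb : 0 < μ (Metric.ball ξ (ε / 2)) :=
    (Measure.mem_support_iff_forall ξ).1 hξ _ (Metric.ball_mem_nhds ξ (half_pos hε))
  have hb' : 0 < μ.real (Metric.ball ξ (ε / 2)) :=
    ENNReal.toReal_pos hb.ne' (measure_ne_top _ _)
  have hpos : 0 < (ε / 2) ^ 2 * μ.real (Metric.ball ξ (ε / 2)) := by positivity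
  filter_upwards [(tendsto_distortion hμ hΓ).eventually_lt_const hpos, eventually_ge_atTop 1]
    with N hN h1
  by_contra hcon
  refine hN.not_ge ?_
  have hs := ((hC N h1).memLp_sub hμ2).integrable_sq
  have hfar : ∀ η ∈ Metric.ball ξ (ε / 2),
      (ε / 2) ^ 2 ≤ (η - voronoiProj (Γ N) (C N) η) ^ 2 := by
    intro η hη
    obtain ⟨i, hi⟩ := (hC N h1).exists_mem η
    have h2 := (hC N h1).abs_sub_voronoiProj_le ξ i
    rw [(hC N h1).voronoiProj_eq hi, ← sq_abs (η - _)]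
    rw [Real.dist_eq, abs_sub_comm, not_lt] at hcon
    rw [Metric.mem_ball, Real.dist_eq, abs_sub_comm] at hη
    have h3 := abs_sub_le ξ η (Γ N i)
    exact pow_le_pow_left₀ (by positivity) (by linarith) 2
  rw [(hC N h1).distortion_eq μ]
  calc (ε / 2) ^ 2 * μ.real (Metric.ball ξ (ε / 2))
      = ∫ _ in Metric.ball ξ (ε / 2), (ε / 2) ^ 2 ∂μ := by
        rw [setIntegral_const, smul_eq_mul, mul_comm]
    _ ≤ ∫ η in Metric.ball ξ (ε / 2), (η - voronoiProj (Γ N) (C N) η) ^ 2 ∂μ :=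
        setIntegral_mono_on (integrable_const _) hs.integrableOn measurableSet_ball hfar
    _ ≤ ∫ η, (η - voronoiProj (Γ N) (C N) η) ^ 2 ∂μ :=
        setIntegral_le_integral hs (.of_forall fun _ => sq_nonneg _)

/-- The slopes at the quantized points converge in `L²`. -/
theorem tendsto_integral_callSlope_sub_sq [IsFiniteMeasure μ] [NullSingletonClass μ]
    (hexp : Integrable (fun ξ : ℝ => Real.exp (4 * |ξ|)) μ)
    (hμ : Integrable (fun ξ : ℝ => (1 + |ξ|) ^ 4) μ) (hμ2 : MemLp (fun ξ : ℝ => ξ) 2 μ)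
    (hΓ : ∀ N, 1 ≤ N → IsOptimalQuantizer μ (Γ N))
    (hC : ∀ N, 1 ≤ N → IsVoronoiPartition (Γ N) (C N)) (K : ℝ) :
    Tendsto (fun N => ∫ ξ, |callSlope K ξ - callSlope K (voronoiProj (Γ N) (C N) ξ)| ^ 2 ∂μ)
      atTop (𝓝 0) := by
  rcases eq_or_ne μ 0 with rfl | hne
  · simp
  obtain ⟨a, ha⟩ := Measure.nonempty_support hne
  -- A single support point `a` anchors the grids: eventually one grid point lies within `1` of `a`,
  -- which bounds every projection by `ξ + |ξ - Γ N i| ≤ 2 * |ξ| + |a| + 1` and yields the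
  -- dominating function.
  have hnear := (Metric.tendsto_nhds.1 (tendsto_voronoiProj hμ hμ2 hΓ hC ha)) 1 one_pos
  have hlim : Tendsto (fun N => ∫ ξ, |callSlope K ξ - callSlope K (voronoiProj (Γ N) (C N) ξ)| ^ 2
      ∂μ) atTop (𝓝 (∫ _, (0 : ℝ) ∂μ)) := by
    refine tendsto_integral_filter_of_dominated_convergence
      (fun ξ => Real.exp (2 * (|a| + 1)) * Real.exp (4 * |ξ|)) ?_ ?_ (hexp.const_mul _) ?_
    · filter_upwards [eventually_ge_atTop 1] with N h1
      have hm := (measurable_callSlope K).sub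
        ((measurable_callSlope K).comp (hC N h1).measurable_voronoiProj)
      exact (hm.abs.pow_const 2).aestronglyMeasurable
    · filter_upwards [hnear, eventually_ge_atTop 1] with N hN h1
      refine .of_forall fun ξ => ?_
      obtain ⟨i, hi⟩ := (hC N h1).exists_mem a
      rw [(hC N h1).voronoiProj_eq hi, Real.dist_eq] at hN
      have h2 := (hC N h1).abs_sub_voronoiProj_le ξ i
      set π := voronoiProj (Γ N) (C N) ξ
      have hΓi : |Γ N i| ≤ |a| + 1 := by
        have := abs_add_le (Γ N i - a) a
        rw [sub_add_cancel] at this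
        linarith
      have hπ : π ≤ 2 * |ξ| + (|a| + 1) := by
        have h4 := abs_sub ξ (Γ N i)
        have h5 := neg_abs_le (ξ - π)
        have h6 := le_abs_self ξ
        linarith
      have hξ : ξ ≤ 2 * |ξ| + (|a| + 1) := by
        linarith [le_abs_self ξ, abs_nonneg ξ, abs_nonneg a]
      have e1 := (callSlope_le K ξ).trans (Real.exp_le_exp.2 hξ)
      have e2 := (callSlope_le K π).trans (Real.exp_le_exp.2 hπ)
      have e3 : |callSlope K ξ - callSlope K π| ≤ Real.exp (2 * |ξ| + (|a| + 1)) := by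
        rw [abs_le]
        constructor <;> linarith [callSlope_nonneg K ξ, callSlope_nonneg K π]
      rw [Real.norm_of_nonneg (by positivity)]
      refine (pow_le_pow_left₀ (abs_nonneg _) e3 2).trans (le_of_eq ?_)
      rw [← Real.exp_nat_mul, ← Real.exp_add]
      congr 1
      push_cast
      ring
    · have hK : ∀ᵐ ξ ∂μ, Real.exp ξ ≠ K := by
        have : {ξ | ¬ Real.exp ξ ≠ K}.Subsingleton := fun u hu v hv =>
          Real.exp_injective ((not_not.1 hu).trans (not_not.1 hv).symm)
        exact this.measure_zero μ
      filter_upwards [Measure.support_mem_ae (μ := μ), hK] with ξ hξ hξK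
      have h := (continuousAt_callSlope hξK).tendsto.comp (tendsto_voronoiProj hμ hμ2 hΓ hC hξ)
      simpa using ((tendsto_const_nhds (x := callSlope K ξ)).sub h).abs.pow 2
  simpa using hlim

/-- The weak error of optimal quantization for the call payoff is `o(1 / N)`. -/
theorem tendsto_mul_abs_integral_callPayoff_sub [IsFiniteMeasure μ] [NullSingletonClass μ]
    (hexp : Integrable (fun ξ : ℝ => Real.exp (4 * |ξ|)) μ)
    (hΓ : ∀ N, 1 ≤ N → IsOptimalQuantizer μ (Γ N))
    (hC : ∀ N, 1 ≤ N → IsVoronoiPartition (Γ N) (C N)) (K : ℝ) :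
    Tendsto (fun N : ℕ => (N : ℝ) * |∫ ξ, callPayoff K ξ ∂μ
      - ∫ ξ, callPayoff K (voronoiProj (Γ N) (C N) ξ) ∂μ|) atTop (𝓝 0) := by
  have hμ := integrable_one_add_abs_pow_four hexp
  have hμ2 := memLp_id_two hexp
  set I := ∫ ξ, (1 + |ξ|) ^ 4 ∂μ
  have hI : 0 ≤ I := integral_nonneg fun _ => by positivity
  have hlim := tendsto_integral_callSlope_sub_sq hexp hμ hμ2 hΓ hC K
  have hlim2 : Tendsto (fun N => √(9 * I) * √(∫ ξ, |callSlope K ξ -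
      callSlope K (voronoiProj (Γ N) (C N) ξ)| ^ 2 ∂μ)) atTop (𝓝 0) := by
    simpa using hlim.sqrt.const_mul (√(9 * I))
  refine squeeze_zero' (.of_forall fun N => by positivity) ?_ hlim2
  filter_upwards [eventually_ge_atTop 2] with N hN
  have hCN := hC N (by omega)
  have hΓN := hΓ N (by omega)
  have hD := hΓN.sq_mul_distortion_le hμ hN
  rw [hCN.distortion_eq μ] at hD
  set π := voronoiProj (Γ N) (C N)
  have hs : MemLp (fun ξ => |ξ - π ξ|) 2 μ := (hCN.memLp_sub hμ2).abs
  have hd : MemLp (fun ξ => |callSlope K ξ - callSlope K (π ξ)|) 2 μ :=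
    ((memLp_callSlope hexp K).sub (hCN.memLp_comp (measurable_callSlope K))).abs
  have i1 : Integrable (callPayoff K) μ := integrable_callPayoff hexp K
  have i2 : Integrable (fun ξ => callPayoff K (π ξ)) μ :=
    hCN.integrable_comp (continuous_callPayoff K).measurable
  have i3 : Integrable (fun ξ => callSlope K (π ξ) * (ξ - π ξ)) μ :=
    (hCN.memLp_comp (measurable_callSlope K)).integrable_mul (hCN.memLp_sub hμ2)
  have i4 : Integrable (fun ξ => callPayoff K ξ - callPayoff K (π ξ)) μ := i1.sub i2
  have hzero := hΓN.integral_comp_mul_sub_eq_zero hCN hμ2 (measurable_callSlope K)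
  have hsplit : ∫ ξ, callPayoff K ξ ∂μ - ∫ ξ, callPayoff K (π ξ) ∂μ
      = ∫ ξ, (callPayoff K ξ - callPayoff K (π ξ) - callSlope K (π ξ) * (ξ - π ξ)) ∂μ := by
    rw [integral_sub i4 i3, hzero, sub_zero, integral_sub i1 i2]
  have hCS := integral_mul_le_Lp_mul_Lq_of_nonneg (μ := μ) Real.HolderConjugate.two_two
    (.of_forall fun ξ => abs_nonneg (callSlope K ξ - callSlope K (π ξ)))
    (.of_forall fun ξ => abs_nonneg (ξ - π ξ)) (by simpa using hd) (by simpa using hs)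
  simp only [Real.rpow_two, ← Real.sqrt_eq_rpow, sq_abs] at hCS
  simp only [sq_abs]
  have hN0 : (0 : ℝ) ≤ N := Nat.cast_nonneg N
  calc (N : ℝ) * |∫ ξ, callPayoff K ξ ∂μ - ∫ ξ, callPayoff K (π ξ) ∂μ|
      ≤ N * ∫ ξ, |callSlope K ξ - callSlope K (π ξ)| * |ξ - π ξ| ∂μ := by
        rw [hsplit]
        gcongr
        refine (abs_integral_le_integral_abs).trans (integral_mono (i4.sub i3).abs
          (hd.integrable_mul hs) fun ξ => abs_callPayoff_sub_sub_le K (π ξ) ξ)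
    _ ≤ N * (√(∫ ξ, (callSlope K ξ - callSlope K (π ξ)) ^ 2 ∂μ)
          * √(∫ ξ, (ξ - π ξ) ^ 2 ∂μ)) := by gcongr
    -- The whole factor `N` goes to the distortion, where it is absorbed by the bound `9 * I`.
    _ = √(N ^ 2 * ∫ ξ, (ξ - π ξ) ^ 2 ∂μ)
          * √(∫ ξ, (callSlope K ξ - callSlope K (π ξ)) ^ 2 ∂μ) := by
        rw [Real.sqrt_mul (by positivity), Real.sqrt_sq hN0]
        ring
    _ ≤ _ := by gcongr

end Convergence

end SVJ

namespace SVJ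

/-! ### Densities with super-exponential decay -/

theorem integrable_exp_neg_abs : Integrable (fun x : ℝ => Real.exp (-|x|)) := by
  refine (integrable_inv_one_add_sq.const_mul 2).mono' (by fun_prop) (.of_forall fun x => ?_)
  have h := Real.quadratic_le_exp_of_nonneg (abs_nonneg x)
  rw [sq_abs] at h
  rw [Real.norm_of_nonneg (by positivity), Real.exp_neg, ← div_eq_mul_inv,
    inv_le_comm₀ (by positivity) (by positivity), inv_div]
  linarith [abs_nonneg x]

theorem exists_abs_aeval_le (q : Polynomial ℤ) :
    ∃ B, 0 ≤ B ∧ ∀ y : ℝ, |Polynomial.aeval y q| ≤ B * Real.exp |y| := by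
  induction q using Polynomial.induction_on' with
  | add p q hp hq =>
    obtain ⟨B, hB0, hB⟩ := hp
    obtain ⟨D, hD0, hD⟩ := hq
    refine ⟨B + D, by positivity, fun y => ?_⟩
    rw [map_add, add_mul]
    exact (abs_add_le _ _).trans (add_le_add (hB y) (hD y))
  | monomial n c =>
    refine ⟨|(c : ℝ)| * n.factorial, by positivity, fun y => ?_⟩
    have h := Real.pow_div_factorial_le_exp (x := |y|) (abs_nonneg y) n
    rw [div_le_iff₀ (by positivity)] at h
    simp only [Polynomial.aeval_monomial, eq_intCast, abs_mul, abs_pow]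
    rw [mul_assoc, mul_comm (n.factorial : ℝ)]
    gcongr

/-- `g` decays faster than every exponential. -/
def SuperExpDecay (g : ℝ → ℝ) : Prop :=
  ∀ a : ℝ, ∃ B, 0 ≤ B ∧ ∀ x, |g x| ≤ B * Real.exp (-(a * |x|))

theorem SuperExpDecay.sum {ι : Type*} {s : Finset ι} {g : ι → ℝ → ℝ}
    (hg : ∀ i ∈ s, SuperExpDecay (g i)) : SuperExpDecay fun x => ∑ i ∈ s, g i x := by
  intro a
  choose! B hB0 hB using fun i hi => hg i hi a
  refine ⟨∑ i ∈ s, B i, Finset.sum_nonneg hB0, fun x => ?_⟩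
  rw [Finset.sum_mul]
  exact (Finset.abs_sum_le_sum_abs _ _).trans (Finset.sum_le_sum fun i hi => hB i hi x)

theorem weight_eq {σw : ℝ≥0} (hσ : 0 < σw) (μw x : ℝ) :
    weight μw σw x = (√(2 * Real.pi * (σw : ℝ) ^ 2))⁻¹ * Real.exp (-((x - μw) / σw) ^ 2 / 2) := by
  have : (0 : ℝ) < σw := hσ
  rw [weight, gaussianPDFReal]
  push_cast
  congr 2
  field_simp

theorem superExpDecay_genHermite_mul_weight (c μw : ℝ) {σw : ℝ≥0} (hσ : 0 < σw) (n : ℕ) :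
    SuperExpDecay fun x => c * genHermite μw σw n x * weight μw σw x := by
  intro a
  have hs : (0 : ℝ) < σw := hσ
  obtain ⟨B, hB0, hB⟩ := exists_abs_aeval_le (Polynomial.hermite n)
  set w := (√(2 * Real.pi * (σw : ℝ) ^ 2))⁻¹
  have hw : 0 ≤ w := by positivity
  -- Completing the square gives `-y² / 2 ≤ b² / 2 - b * |y|` for every `b`. In this choice `|a| *
  -- σw` produces the rate `|a|` in `x`, and `1` absorbs the `exp |y|` that bounds the polynomial.
  set b := |a| * σw + 1
  refine ⟨|c| * (1 / √(n.factorial : ℝ) * B) * (w * Real.exp (b ^ 2 / 2)) * Real.exp (|a| * |μw|),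
    by positivity, fun x => ?_⟩
  beta_reduce
  rw [weight_eq hσ, genHermite, abs_mul, abs_mul, abs_mul]
  set y := (x - μw) / σw with hy
  have hyx : (σw : ℝ) * |y| = |x - μw| := by
    rw [hy, abs_div, abs_of_pos hs]
    field_simp
  have h1 : Real.exp (-y ^ 2 / 2) ≤ Real.exp (b ^ 2 / 2) * Real.exp (-(b * |y|)) := by
    rw [← Real.exp_add, Real.exp_le_exp]
    nlinarith [sq_nonneg (|y| - b), sq_abs y]
  have h2 : Real.exp |y| * Real.exp (-(b * |y|)) ≤
      Real.exp (|a| * |μw|) * Real.exp (-(a * |x|)) := by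
    rw [← Real.exp_add, ← Real.exp_add, Real.exp_le_exp]
    have e : |y| + -(b * |y|) = -(|a| * |x - μw|) := by rw [← hyx]; ring
    have h3 : |x| ≤ |x - μw| + |μw| := by simpa using abs_add_le (x - μw) μw
    have h4 := mul_le_mul_of_nonneg_left h3 (abs_nonneg a)
    have h5 := mul_le_mul_of_nonneg_right (le_abs_self a) (abs_nonneg x)
    rw [e]
    linarith
  rw [abs_of_nonneg (by positivity : 0 ≤ 1 / √(n.factorial : ℝ)), abs_of_nonneg
    (by positivity : 0 ≤ w * Real.exp (-y ^ 2 / 2))]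
  calc |c| * (1 / √(n.factorial : ℝ) * |Polynomial.aeval y (Polynomial.hermite n)|)
        * (w * Real.exp (-y ^ 2 / 2))
      ≤ |c| * (1 / √(n.factorial : ℝ) * (B * Real.exp |y|))
        * (w * (Real.exp (b ^ 2 / 2) * Real.exp (-(b * |y|)))) := by
        gcongr
        exact hB y
    _ = |c| * (1 / √(n.factorial : ℝ) * B) * (w * Real.exp (b ^ 2 / 2))
        * (Real.exp |y| * Real.exp (-(b * |y|))) := by ring
    _ ≤ |c| * (1 / √(n.factorial : ℝ) * B) * (w * Real.exp (b ^ 2 / 2))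
        * (Real.exp (|a| * |μw|) * Real.exp (-(a * |x|))) := by gcongr
    _ = _ := by ring

theorem continuous_genHermite (μw : ℝ) (σw : ℝ≥0) (n : ℕ) : Continuous (genHermite μw σw n) := by
  unfold genHermite
  have := (Polynomial.hermite n).continuous_aeval (A := ℝ)
  fun_prop

theorem continuous_weight (μw : ℝ) (σw : ℝ≥0) : Continuous (weight μw σw) := by
  unfold weight gaussianPDFReal
  fun_prop

section TruncDensity

variable {Ω : Type*} [MeasurableSpace Ω] (P : Measure Ω) (Y : Ω → ℝ) (μw : ℝ) (M : ℕ)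

theorem continuous_truncDensity (σw : ℝ≥0) : Continuous (truncDensity P Y μw σw M) :=
  continuous_finsetSum _ fun n _ =>
    (continuous_const.mul (continuous_genHermite μw σw n)).mul (continuous_weight μw σw)

theorem superExpDecay_truncDensity {σw : ℝ≥0} (hσ : 0 < σw) :
    SuperExpDecay (truncDensity P Y μw σw M) :=
  SuperExpDecay.sum fun n _ => superExpDecay_genHermite_mul_weight _ μw hσ n

end TruncDensity

/-! ### Laws with a rapidly decaying density, and their images under `exp` -/

section Density

variable {g : ℝ → ℝ}

theorem SuperExpDecay.integrable_exp_mul_abs_mul (hd : SuperExpDecay g) (hg : Continuous g)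
    (a : ℝ) : Integrable fun x => Real.exp (a * |x|) * g x := by
  obtain ⟨B, hB0, hB⟩ := hd (a + 1)
  refine (integrable_exp_neg_abs.const_mul B).mono' (by fun_prop) (.of_forall fun x => ?_)
  rw [norm_mul, Real.norm_eq_abs, Real.norm_eq_abs, abs_of_pos (Real.exp_pos _)]
  calc Real.exp (a * |x|) * |g x| ≤ Real.exp (a * |x|) * (B * Real.exp (-((a + 1) * |x|))) := by
        gcongr
        exact hB x
    _ = B * (Real.exp (a * |x|) * Real.exp (-((a + 1) * |x|))) := by ring
    _ = B * Real.exp (-|x|) := by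
        rw [← Real.exp_add]
        congr 2
        ring

theorem SuperExpDecay.integrable (hd : SuperExpDecay g) (hg : Continuous g) : Integrable g := by
  simpa using hd.integrable_exp_mul_abs_mul hg 0

theorem isFiniteMeasure_densityLaw (hg : Integrable g) : IsFiniteMeasure (densityLaw g) :=
  isFiniteMeasure_withDensity_ofReal hg.2

theorem integral_densityLaw (hg : Measurable g) (h0 : ∀ x, 0 ≤ g x) (f : ℝ → ℝ) :
    ∫ x, f x ∂densityLaw g = ∫ x, f x * g x := by
  rw [densityLaw, integral_withDensity_eq_integral_toReal_smul (by fun_prop) (by simp)]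
  simp [ENNReal.toReal_ofReal (h0 _), mul_comm]

theorem setIntegral_densityLaw (hg : Measurable g) (h0 : ∀ x, 0 ≤ g x) (f : ℝ → ℝ) {s : Set ℝ}
    (hs : MeasurableSet s) : ∫ x in s, f x ∂densityLaw g = ∫ x in s, f x * g x := by
  rw [densityLaw, restrict_withDensity hs,
    integral_withDensity_eq_integral_toReal_smul (by fun_prop) (by simp)]
  simp [ENNReal.toReal_ofReal (h0 _), mul_comm]

theorem SuperExpDecay.integrable_exp_densityLaw (hd : SuperExpDecay g) (hg : Continuous g)
    (h0 : ∀ x, 0 ≤ g x) : Integrable (fun x => Real.exp (4 * |x|)) (densityLaw g) := by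
  rw [densityLaw, integrable_withDensity_iff (by fun_prop) (by simp)]
  simpa [ENNReal.toReal_ofReal (h0 _)] using hd.integrable_exp_mul_abs_mul hg 4

/-- Change of variables `y = exp x`. A general `s` identifies the image measure; `s = univ` serves
for the `1/3`-norm. -/
theorem lintegral_Ioi_eq_lintegral_exp (F : ℝ → ℝ≥0∞) (s : Set ℝ) (hs : MeasurableSet s) :
    ∫⁻ y in s ∩ Set.Ioi 0, F y
      = ∫⁻ x in Real.exp ⁻¹' s, ENNReal.ofReal (Real.exp x) * F (Real.exp x) := by
  have h := lintegral_image_eq_lintegral_abs_deriv_mul (s := Real.exp ⁻¹' s)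
    (Real.measurable_exp hs) (fun x _ => (Real.hasDerivAt_exp x).hasDerivWithinAt)
    Real.exp_injective.injOn F
  rw [Set.image_preimage_eq_inter_range, Real.range_exp] at h
  simpa using h

theorem map_exp_densityLaw (g : ℝ → ℝ) :
    (densityLaw g).map Real.exp = (volume.restrict (Set.Ioi 0)).withDensity
      fun s => ENNReal.ofReal (expDensity g s) := by
  ext s hs
  rw [Measure.map_apply Real.measurable_exp hs, densityLaw,
    withDensity_apply _ (Real.measurable_exp hs), withDensity_apply _ hs,
    Measure.restrict_restrict hs, lintegral_Ioi_eq_lintegral_exp _ s hs]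
  refine lintegral_congr fun x => ?_
  rw [expDensity, Real.log_exp, ← ENNReal.ofReal_mul (Real.exp_pos x).le,
    mul_div_cancel₀ _ (Real.exp_pos x).ne']

theorem SuperExpDecay.memLp_expDensity (hd : SuperExpDecay g) (hg : Continuous g) :
    MemLp (expDensity g) (1 / 3) (volume.restrict (Set.Ioi 0)) := by
  have hm : Measurable (expDensity g) :=
    (hg.measurable.comp Real.measurable_log).div measurable_id
  refine ⟨hm.aestronglyMeasurable, ?_⟩
  rw [eLpNorm_lt_top_iff_lintegral_rpow_enorm_lt_top (by simp) (by simp),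
    ← Set.univ_inter (Set.Ioi (0 : ℝ)), lintegral_Ioi_eq_lintegral_exp _ _ MeasurableSet.univ,
    Set.preimage_univ, Measure.restrict_univ]
  -- After `s = exp x` the integrand is `exp (2 * x / 3) * |g x| ^ (1 / 3)`; rate `5` leaves `5 / 3
  -- - 2 / 3 = 1`.
  obtain ⟨B, hB0, hB⟩ := hd 5
  have hfin : ∫⁻ x, ENNReal.ofReal (B ^ (1 / 3 : ℝ) * Real.exp (-|x|)) < ∞ :=
    (integrable_exp_neg_abs.const_mul _).lintegral_lt_top
  refine lt_of_le_of_lt (lintegral_mono fun x => ?_) hfin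
  have h3 : (1 / 3 : ℝ≥0∞).toReal = 1 / 3 := by simp
  rw [h3, Real.enorm_eq_ofReal_abs, ENNReal.ofReal_rpow_of_nonneg (abs_nonneg _) (by norm_num),
    ← ENNReal.ofReal_mul (Real.exp_pos x).le]
  refine ENNReal.ofReal_le_ofReal ?_
  rw [expDensity, Real.log_exp, abs_div, abs_of_pos (Real.exp_pos x)]
  have h1 : |g x| / Real.exp x ≤ B * Real.exp (-(5 * |x|) - x) := by
    rw [Real.exp_sub, ← mul_div_assoc]
    gcongr
    exact hB x
  calc Real.exp x * (|g x| / Real.exp x) ^ (1 / 3 : ℝ)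
      ≤ Real.exp x * (B * Real.exp (-(5 * |x|) - x)) ^ (1 / 3 : ℝ) := by gcongr
    _ = B ^ (1 / 3 : ℝ) * Real.exp (x + (-(5 * |x|) - x) * (1 / 3)) := by
        rw [Real.mul_rpow hB0 (Real.exp_pos _).le, ← Real.exp_mul, Real.exp_add]
        ring
    _ ≤ B ^ (1 / 3 : ℝ) * Real.exp (-|x|) := by
        gcongr
        linarith [le_abs_self x]

/-! ### The quantization error -/

/-- The projection is constant on each cell, so the sum over cells is one integral against the law.
-/
theorem quantError_eq (hg : Continuous g) (hi : Integrable g) (h0 : ∀ x, 0 ≤ g x) (r T K : ℝ)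
    {N : ℕ} {x : Fin N → ℝ} {C : Fin N → Set ℝ} (hC : IsVoronoiPartition x C) :
    quantError r T K g x C = Real.exp (-r * T) * |∫ ξ, callPayoff K ξ ∂densityLaw g
      - ∫ ξ, callPayoff K (voronoiProj x C ξ) ∂densityLaw g| := by
  have := isFiniteMeasure_densityLaw hi
  have hint : Integrable (fun ξ => callPayoff K (voronoiProj x C ξ)) (densityLaw g) :=
    hC.integrable_comp (continuous_callPayoff K).measurable
  have hsum : ∑ i, ∫ ξ in C i, max (Real.exp (x i) - K) 0 * g ξ
      = ∫ ξ, callPayoff K (voronoiProj x C ξ) ∂densityLaw g := by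
    rw [← setIntegral_univ (μ := densityLaw g), ← hC.cover, integral_iUnion_fintype hC.measurable
      hC.disjoint fun i => hint.integrableOn]
    refine Finset.sum_congr rfl fun i _ => ?_
    rw [← setIntegral_densityLaw hg.measurable h0 (fun _ => max (Real.exp (x i) - K) 0)
      (hC.measurable i)]
    refine setIntegral_congr_fun (hC.measurable i) fun ξ hξ => ?_
    simp only [hC.voronoiProj_eq hξ, callPayoff]
  rw [quantError, callPrice, quantizedCallPrice, hsum,
    ← integral_densityLaw hg.measurable h0 fun ξ => max (Real.exp ξ - K) 0, ← mul_sub, abs_mul,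
    abs_of_pos (Real.exp_pos _)]
  rfl

/-- Optimal quantizers are stationary, so the error is `o(1 / N)`. -/
theorem tendsto_mul_quantError (hd : SuperExpDecay g) (hg : Continuous g) (h0 : ∀ x, 0 ≤ g x)
    (r T K : ℝ) {Γ : (N : ℕ) → Fin N → ℝ} {C : (N : ℕ) → Fin N → Set ℝ}
    (hΓ : ∀ N, 1 ≤ N → IsOptimalQuantizer (densityLaw g) (Γ N))
    (hC : ∀ N, 1 ≤ N → IsVoronoiPartition (Γ N) (C N)) :
    Tendsto (fun N : ℕ => (N : ℝ) * quantError r T K g (Γ N) (C N)) atTop (𝓝 0) := by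
  have hi := hd.integrable hg
  have := isFiniteMeasure_densityLaw hi
  have hna : NullSingletonClass (densityLaw g) := by
    unfold densityLaw
    infer_instance
  have h := (tendsto_mul_abs_integral_callPayoff_sub (hd.integrable_exp_densityLaw hg h0) hΓ hC
    K).const_mul (Real.exp (-r * T))
  rw [mul_zero] at h
  refine h.congr' ?_
  filter_upwards [eventually_ge_atTop 1] with N hN
  rw [quantError_eq hg hi h0 r T K (hC N hN)]
  ring

end Density

end SVJ

theorem theorem4p4 {Ω : Type*} [mΩ : MeasurableSpace Ω] (P : Measure Ω) [IsProbabilityMeasure P]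
    (p : SVJ.Params) (hp : p.Admissible) (T : ℝ) (hT : 0 < T)
    (ℱ : Filtration (Set.Icc (0 : ℝ) T) mΩ) (V X : ℝ → Ω → ℝ)
    (hVX : SVJ.IsSolution p T ℱ P V X)
    (K μw : ℝ) (σw : ℝ≥0) (hσw : p.vmax * T / 2 < (σw : ℝ) ^ 2)
    (M : ℕ) (hM : 0 < M)
    (g h : ℝ → ℝ) (hg : g = SVJ.truncDensity P (X T) μw σw M) (hh : h = SVJ.expDensity g)
    (hg_nonneg : ∀ x, 0 ≤ g x)
    (Γ : (N : ℕ) → Fin N → ℝ) (C : (N : ℕ) → Fin N → Set ℝ)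
    (hΓ : ∀ N, 1 ≤ N → SVJ.IsOptimalQuantizer (SVJ.densityLaw g) (Γ N))
    (hC : ∀ N, 1 ≤ N → SVJ.IsVoronoiPartition (Γ N) (C N)) :
    (SVJ.densityLaw g).map Real.exp
        = (volume.restrict (Set.Ioi 0)).withDensity (fun s => ENNReal.ofReal (h s)) ∧
    MemLp h (1 / 3) (volume.restrict (Set.Ioi 0)) ∧
    ∃ L : ℝ,
      Tendsto (fun N : ℕ => (N : ℝ) * SVJ.quantError p.r T K g (Γ N) (C N)) atTop (𝓝 L) ∧
      L ≤ (eLpNorm h (1 / 3) (volume.restrict (Set.Ioi 0))).toReal ^ (1 / 2 : ℝ)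
            / (2 * √3) := by
  -- The variance bound excludes the degenerate value `σw = 0`, so the weight is a genuine Gaussian
  -- density.
  have hσ : 0 < σw := by
    have hv : 0 < p.vmax := hp.vmin_pos.trans hp.vmin_lt_vmax
    have h1 : 0 < (σw : ℝ) ^ 2 := lt_trans (by positivity) hσw
    exact pos_iff_ne_zero.2 fun h => by simp [h] at h1
  have hcont : Continuous g := hg ▸ SVJ.continuous_truncDensity P (X T) μw M σw
  have hdecay : SVJ.SuperExpDecay g := hg ▸ SVJ.superExpDecay_truncDensity P (X T) μw M hσ
  subst hh
  -- The witness for the limit is `0`.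
  exact ⟨SVJ.map_exp_densityLaw g, hdecay.memLp_expDensity hcont, 0,
    SVJ.tendsto_mul_quantError hdecay hcont hg_nonneg p.r T K hΓ hC, by positivity⟩
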